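/- Let $\mathbb U=\{z\in\mathbb C:|z|<1\}$, and let $\mathcal A$ be the class of analytic functions $f(z)=z+\sum_{n\ge2}a_nz^n$ on $\mathbb U$. Let $\sigma$ be the class of those $h\in\mathcal A$ that are univalent in $\mathbb U$ and whose inverse near $0$ continues analytically to a univalent function $k=h^{-1}$ on $\mathbb U$. Write $F\prec G$ if $F=G\circ w$ on $\mathbb U$ for some analytic $w:\mathbb U\to\mathbb U$ with $w(0)=0$. Let $\mu\ge0$, $\delta\ge1$, $t\in(1/2,1]$, and put $$G(z,t)=\frac1{1-2tz+z^2},\qquad f_\delta(z)=\int_0^z\Big(\frac{1+r}{1-r}\Big)^{\delta}\frac{dr}{1-r^2}=z+\sum_{n\ge2}b_n(\delta)z^n .$$ For $f\in\mathcal A$ let $h_\delta(z)=(f*f_\delta)(z)=z+\sum_{n\ge2}a_nb_n(\delta)z^n$. Suppose that $h_\delta\in\mathcal B_\sigma^{\mu,\delta}(t)$, that is, $h_\delta\in\sigma$ and, with $k_\delta=h_\delta^{-1}$, $$h_\delta'(z)\Big(\frac{h_\delta(z)}z\Big)^{\mu-1}\prec G(z,t),\qquad k_\delta'(w)\Big(\frac{k_\delta(w)}w\Big)^{\mu-1}\prec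 G(w,t),$$ where the powers are the analytic branches on $\mathbb U$ equal to $1$ at the origin. Then $$|a_2a_4-a_3^2|\le\begin{cases} \varphi(2^-,t), & \chi_5\ge0\text{ and }\chi_6\ge0,\\[1mm] \dfrac{36t^2}{(2\delta^2+1)^2(2+\mu)^2}, & \chi_5\le0\text{ and }\chi_6\le0,\\[2mm] \max\Big\{\dfrac{36t^2}{(2\delta^2+1)^2(2+\mu)^2},\ \varphi(2^-,t)\Big\}, & \chi_5>0\text{ and }\chi_6<0,\\[2mm] \max\{\varphi(c_0,t),\ \varphi(2^-,t)\}, & \chi_5<0\text{ and }\chi_6>0, \end{cases}$$ where $\varphi(2^-,t)$ and $\varphi(c_0,t)$ denote the numbers $$\varphi(2^-,t)=\frac{9U_1^2(t)}{(2\delta^2+1)^2(2+\mu)^2}+\frac{\chi_5+9\chi_6}{6\delta(\delta^3+2\delta)(2\delta^2+1)^2(3+\mu)(2+\mu)^2(1+\mu)^4},$$ $$\varphi(c_0,t)=\frac{9U_1^2(t)}{(2\delta^2+1)^2(2+\mu)^2}-\frac{27\chi_6^2}{8\chi_5\,\delta(\delta^3+2\delta)(2\delta^2+1)^2(3+\mu)(2+\mu)^2(1+\mu)^4},$$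 $U_n$ is the Chebyshev polynomial of the second kind ($U_1(t)=2t$, $U_2(t)=4t^2-1$, $U_3(t)=8t^3-4t$), and $\chi_5=\chi_1(1,\mu,\delta;t)$, $\chi_6=\chi_2(1,\mu,\delta;t)$ with $$\begin{aligned} \chi_1(\lambda,\mu,\delta;t)={}&(2\lambda+\mu)^2U_1(t)\,|\Omega_{\lambda,\mu,\delta}(t)|\\ &+18(\lambda+\mu)^3\big(3\delta(\delta^3+2\delta)(\lambda+\mu)(3\lambda+\mu)-(2\delta^2+1)^2(2\lambda+\mu)^2\big)U_1^2(t)\\ &-9(\lambda+\mu)^2(2\lambda+\mu)U_1(t)\big((3\lambda+\mu)(8\delta^4-4\delta^2+5)U_1^2(t)+4(2\delta^2+1)^2(2\lambda+\mu)(\lambda+\mu)U_2(t)\big),\\ \chi_2(\lambda,\mu,\delta;t)={}&\big[(2\lambda+\mu)(3\lambda+\mu)(8\delta^4-4\delta^2+5)U_1^3(t)+4(2\delta^2+1)^2(\lambda+\mu)(2\lambda+\mu)^2U_1(t)U_2(t)\\ &+(\lambda+\mu)U_1^2(t)\big(2(2\delta^2+1)^2(2\lambda+\mu)^2-12\delta(\delta^3+2\delta)(\lambda+\mu)(3\lambda+\mu)\big)\big](\lambda+\mu)^2,\\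 \Omega_{\lambda,\mu,\delta}(t)={}&18(2\delta^2+1)^2(\lambda+\mu)^3U_3(t)-U_1^3(t)(3\lambda+\mu)\big(3(2\delta^2+1)^2(\mu^2+3\mu-4)+54\delta(\delta^3+2\delta)\big). \end{aligned}$$ -/

import Mathlib

namespace BiUnivalentHankel

/-- The open unit disk. -/
def unitDisk : Set ℂ := Metric.ball (0 : ℂ) 1

/-- The `n`-th Taylor coefficient of `f` at the origin. -/
noncomputable def coeff (f : ℂ → ℂ) (n : ℕ) : ℂ :=
  iteratedDeriv n f 0 / (n.factorial : ℂ)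

/-- The class `𝒜`: functions analytic in the unit disk, normalized by
`f(z) = z + ∑_{n ≥ 2} a_n z^n`. -/
def classA : Set (ℂ → ℂ) :=
  {f | DifferentiableOn ℂ f unitDisk ∧ f 0 = 0 ∧ deriv f 0 = 1}

/-- `k` is the inverse of `h` near the origin, continued to a univalent analytic function on the
whole unit disk. Such a `k` is unique on the disk when `h ∈ 𝒜`. -/
def IsUnivalentInverse (h k : ℂ → ℂ) : Prop :=
  DifferentiableOn ℂ k unitDisk ∧ Set.InjOn k unitDisk ∧
    ∀ᶠ z in nhds (0 : ℂ), k (h z) = z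

/-- The class `σ` of bi-univalent functions. -/
def classSigma : Set (ℂ → ℂ) :=
  {h | h ∈ classA ∧ Set.InjOn h unitDisk ∧ ∃ k, IsUnivalentInverse h k}

/-- Subordination `F ≺ G` in the unit disk. -/
def Subordinate (F G : ℂ → ℂ) : Prop :=
  ∃ w : ℂ → ℂ, DifferentiableOn ℂ w unitDisk ∧ w 0 = 0 ∧
    (∀ z ∈ unitDisk, ‖w z‖ < 1) ∧ ∀ z ∈ unitDisk, F z = G (w z)

/-- The Hadamard product (convolution) of two power series at the origin. -/
noncomputable def hadamard (f g : ℂ → ℂ) : ℂ → ℂ :=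
  fun z => ∑' n : ℕ, coeff f n * coeff g n * z ^ n

/-- `f_δ(z) = ∫₀^z ((1 + r) / (1 - r))^δ (1 - r²)⁻¹ dr`, integrated along the segment
`r = s z`, `0 ≤ s ≤ 1`. -/
noncomputable def fDelta (delta : ℝ) : ℂ → ℂ := fun z =>
  ∫ s in (0 : ℝ)..1,
    (((1 + (s : ℂ) * z) / (1 - (s : ℂ) * z)) ^ (delta : ℂ) *
      (1 / (1 - ((s : ℂ) * z) ^ 2))) * z

/-- The generating function `G(z, t) = 1 / (1 - 2 t z + z²)`. -/
noncomputable def chebG (t : ℝ) : ℂ → ℂ := fun z => 1 / (1 - 2 * (t : ℂ) * z + z ^ 2)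

/-- The relation `(1 - λ) (h(z)/z)^μ + λ h'(z) (h(z)/z)^(μ-1) ≺ G(z, t)`. The powers are the
analytic branches on the disk that take the value `1` at the origin: `L` is the analytic logarithm
of `h(z)/z` with `L(0) = 0`. -/
def BazilevicSubordinate (lam mu t : ℝ) (h : ℂ → ℂ) : Prop :=
  ∃ L : ℂ → ℂ, DifferentiableOn ℂ L unitDisk ∧ L 0 = 0 ∧
    (∀ z ∈ unitDisk, h z = z * Complex.exp (L z)) ∧
    Subordinate
      (fun z => (1 - (lam : ℂ)) * Complex.exp ((mu : ℂ) * L z) +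
        (lam : ℂ) * deriv h z * Complex.exp (((mu : ℂ) - 1) * L z))
      (chebG t)

/-- The class `𝒩_σ^{μ,δ}(λ, t)`: bi-univalent functions `h = f * f_δ` with `f ∈ 𝒜` such that
both `h` and its inverse `k` satisfy the subordination. -/
def classN (lam mu delta t : ℝ) : Set (ℂ → ℂ) :=
  {h | (∃ f ∈ classA, Set.EqOn h (hadamard f (fDelta delta)) unitDisk) ∧ h ∈ classSigma ∧
    BazilevicSubordinate lam mu t h ∧
    ∃ k, IsUnivalentInverse h k ∧ BazilevicSubordinate lam mu t k}

/-- The class `ℬ_σ^{μ,δ}(t)` of bi-Bazilevič type: the case `λ = 1`. -/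
def classB (mu delta t : ℝ) : Set (ℂ → ℂ) := classN 1 mu delta t

/-- The value `U_n(t)` of the Chebyshev polynomial of the second kind. -/
noncomputable def chebU (n : ℕ) (t : ℝ) : ℝ := (Polynomial.Chebyshev.U ℝ (n : ℤ)).eval t

/-- `Ω_{λ,μ,δ}(t)`. -/
noncomputable def Omega (lam mu delta t : ℝ) : ℝ :=
  18 * (2 * delta ^ 2 + 1) ^ 2 * (lam + mu) ^ 3 * chebU 3 t -
    chebU 1 t ^ 3 * (3 * lam + mu) *
      (3 * (2 * delta ^ 2 + 1) ^ 2 * (mu ^ 2 + 3 * mu - 4) +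
        54 * delta * (delta ^ 3 + 2 * delta))

/-- `χ₁(λ, μ, δ; t)`. -/
noncomputable def chi1 (lam mu delta t : ℝ) : ℝ :=
  (2 * lam + mu) ^ 2 * chebU 1 t * |Omega lam mu delta t| +
    18 * (lam + mu) ^ 3 *
      (3 * delta * (delta ^ 3 + 2 * delta) * (lam + mu) * (3 * lam + mu) -
        (2 * delta ^ 2 + 1) ^ 2 * (2 * lam + mu) ^ 2) * chebU 1 t ^ 2 -
    9 * (lam + mu) ^ 2 * (2 * lam + mu) * chebU 1 t *
      ((3 * lam + mu) * (8 * delta ^ 4 - 4 * delta ^ 2 + 5) * chebU 1 t ^ 2 +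
        4 * (2 * delta ^ 2 + 1) ^ 2 * (2 * lam + mu) * (lam + mu) * chebU 2 t)

/-- `χ₂(λ, μ, δ; t)`. -/
noncomputable def chi2 (lam mu delta t : ℝ) : ℝ :=
  ((2 * lam + mu) * (3 * lam + mu) * (8 * delta ^ 4 - 4 * delta ^ 2 + 5) * chebU 1 t ^ 3 +
    4 * (2 * delta ^ 2 + 1) ^ 2 * (lam + mu) * (2 * lam + mu) ^ 2 * chebU 1 t * chebU 2 t +
    (lam + mu) * chebU 1 t ^ 2 *
      (2 * (2 * delta ^ 2 + 1) ^ 2 * (2 * lam + mu) ^ 2 -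
        12 * delta * (delta ^ 3 + 2 * delta) * (lam + mu) * (3 * lam + mu))) * (lam + mu) ^ 2

/-- `χ₅ = χ₁(1, μ, δ; t)`. -/
noncomputable def chi5 (mu delta t : ℝ) : ℝ := chi1 1 mu delta t

/-- `χ₆ = χ₂(1, μ, δ; t)`. -/
noncomputable def chi6 (mu delta t : ℝ) : ℝ := chi2 1 mu delta t

/-- `φ(2⁻, t)` for `λ = 1`. -/
noncomputable def phiTwo (mu delta t : ℝ) : ℝ :=
  9 * chebU 1 t ^ 2 / ((2 * delta ^ 2 + 1) ^ 2 * (2 + mu) ^ 2) +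
    (chi5 mu delta t + 9 * chi6 mu delta t) /
      (6 * delta * (delta ^ 3 + 2 * delta) * (2 * delta ^ 2 + 1) ^ 2 * (3 + mu) *
        (2 + mu) ^ 2 * (1 + mu) ^ 4)

/-- `φ(c₀, t)` for `λ = 1`; used only when `χ₅ < 0`. -/
noncomputable def phiCrit (mu delta t : ℝ) : ℝ :=
  9 * chebU 1 t ^ 2 / ((2 * delta ^ 2 + 1) ^ 2 * (2 + mu) ^ 2) -
    27 * chi6 mu delta t ^ 2 /
      (8 * chi5 mu delta t * delta * (delta ^ 3 + 2 * delta) * (2 * delta ^ 2 + 1) ^ 2 *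
        (3 + mu) * (2 + mu) ^ 2 * (1 + mu) ^ 4)

end BiUnivalentHankel

namespace BiUnivalentHankel

open Filter Topology ComplexConjugate

/-! ### Calculus of Taylor coefficients at the origin -/

section TaylorCoefficients

variable {f g : ℂ → ℂ}

/-! Write `h = z·exp L` near the origin. Then `h'(h/z)^(μ-1) = (1 + z L')·exp(μ L)`, and
subordination equates its coefficients with those of `G ∘ w` for a Schwarz function `w`
(`BazilevicSubordinate.exists_log`). The inverse `k = z·exp M` gives a second such system, and `k ∘
h = id` becomes `L + M ∘ h = 0` (`coeff_log_inverse`). Eliminating `M` forces the first Schwarz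
coefficients to be opposite and expresses the coefficients of `h` through those of the two Schwarz
functions (`coeff_of_log_relations`). Dividing by the coefficients of `f_δ` turns `a₂a₄ - a₃²` into
an explicit polynomial (`hankel_identity`).

Schur's algorithm parametrizes each Schwarz triple by points `c₁, x, ξ` of the closed disk
(`isSchurTriple_coeff`). After the triangle inequality the bound is largest when both second
parameters have modulus one (`majorant_le`). What remains is a quadratic in `P = ‖c₁‖²` on `[0, 1]`,
with zero constant term apart from the value at `P = 0`, and with coefficients proportional to `9χ₆`
and `χ₅` (`majorant_eq`). The four cases bound this quadratic: `36t²/…` is its value at `P = 0`,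
`φ(2⁻)` at `P = 1`, and `φ(c₀)` at the vertex. -/

lemma coeff_congr (hfg : f =ᶠ[𝓝 0] g) (n : ℕ) : coeff f n = coeff g n := by
  rw [coeff, coeff, hfg.iteratedDeriv_eq]

lemma coeff_zero (f : ℂ → ℂ) : coeff f 0 = f 0 := by simp [coeff]

lemma coeff_deriv (f : ℂ → ℂ) (n : ℕ) : coeff (deriv f) n = (n + 1) * coeff f (n + 1) := by
  rw [coeff, coeff, iteratedDeriv_succ', Nat.factorial_succ]
  have h₁ : (n.factorial : ℂ) ≠ 0 := mod_cast n.factorial_ne_zero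
  have h₂ : (n : ℂ) + 1 ≠ 0 := mod_cast n.succ_ne_zero
  push_cast
  field_simp

lemma coeff_add (hf : AnalyticAt ℂ f 0) (hg : AnalyticAt ℂ g 0) (n : ℕ) :
    coeff (fun z => f z + g z) n = coeff f n + coeff g n := by
  rw [coeff, iteratedDeriv_fun_add hf.contDiffAt hg.contDiffAt, add_div, coeff, coeff]

lemma coeff_mul (hf : AnalyticAt ℂ f 0) (hg : AnalyticAt ℂ g 0) (n : ℕ) :
    coeff (fun z => f z * g z) n =
      ∑ i ∈ Finset.range (n + 1), coeff f i * coeff g (n - i) := by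
  rw [coeff, iteratedDeriv_fun_mul hf.contDiffAt hg.contDiffAt, Finset.sum_div]
  refine Finset.sum_congr rfl fun i hi => ?_
  have hin : i ≤ n := Nat.lt_succ_iff.1 (Finset.mem_range.1 hi)
  rw [coeff, coeff, Nat.cast_choose ℂ hin]
  have h₁ : (n.factorial : ℂ) ≠ 0 := mod_cast n.factorial_ne_zero
  have h₂ : (i.factorial : ℂ) ≠ 0 := mod_cast i.factorial_ne_zero
  have h₃ : ((n - i).factorial : ℂ) ≠ 0 := mod_cast (n - i).factorial_ne_zero
  field_simp

lemma coeff_const (c : ℂ) (n : ℕ) : coeff (fun _ => c) n = if n = 0 then c else 0 := by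
  rw [coeff, iteratedDeriv_const]
  split_ifs with h <;> simp [h]

lemma coeff_id (n : ℕ) : coeff (fun z => z) n = if n = 1 then 1 else 0 := by
  rw [coeff, iteratedDeriv_fun_id_zero]
  split_ifs with h <;> simp [h]

lemma coeff_const_mul (c : ℂ) (hf : AnalyticAt ℂ f 0) (n : ℕ) :
    coeff (fun z => c * f z) n = c * coeff f n := by
  rw [coeff_mul analyticAt_const hf, Finset.sum_range_succ']
  simp [coeff_const]

lemma coeff_id_mul_zero (f : ℂ → ℂ) : coeff (fun z => z * f z) 0 = 0 := by
  simp [coeff_zero]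

lemma coeff_id_mul_succ (hf : AnalyticAt ℂ f 0) (n : ℕ) :
    coeff (fun z => z * f z) (n + 1) = coeff f n := by
  rw [coeff_mul (f := fun z => z) analyticAt_id hf, Finset.sum_range_succ', Finset.sum_range_succ']
  simp [coeff_id]

/-- Division of an analytic germ vanishing at the origin by the coordinate. -/
lemma exists_analyticAt_eq_add_id_mul (hf : AnalyticAt ℂ f 0) :
    ∃ g : ℂ → ℂ, AnalyticAt ℂ g 0 ∧ ∀ z, f z = f 0 + z * g z := by
  obtain ⟨p, hp⟩ := hf
  refine ⟨dslope f 0, ⟨_, hp.has_fpower_series_dslope_fslope⟩, fun z => ?_⟩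
  have h := sub_smul_dslope f 0 z
  simp only [sub_zero, smul_eq_mul] at h
  rw [h]
  ring

end TaylorCoefficients

/-! ### Schwarz functions -/

lemma unitDisk_mem_nhds : unitDisk ∈ 𝓝 (0 : ℂ) := Metric.ball_mem_nhds _ one_pos

lemma zero_mem_unitDisk : (0 : ℂ) ∈ unitDisk := Metric.mem_ball_self one_pos

lemma analyticAt_of_differentiableOn {f : ℂ → ℂ} (hf : DifferentiableOn ℂ f unitDisk) :
    AnalyticAt ℂ f 0 := hf.analyticAt unitDisk_mem_nhds

/-- One step of the Schur algorithm. -/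
lemma exists_schur_step {g : ℂ → ℂ} (hd : DifferentiableOn ℂ g unitDisk)
    (hb : ∀ z ∈ unitDisk, ‖g z‖ ≤ 1) :
    ∃ s : ℂ → ℂ, DifferentiableOn ℂ s unitDisk ∧ (∀ z ∈ unitDisk, ‖s z‖ ≤ 1) ∧
      ∀ z ∈ unitDisk, g z = g 0 + z * (s z * (1 - conj (g 0) * g z)) := by
  rcases (hb 0 zero_mem_unitDisk).lt_or_eq with h0 | h0
  · have hden : ∀ z ∈ unitDisk, 1 - conj (g 0) * g z ≠ 0 := by
      intro z hz h
      have h1 : ‖conj (g 0) * g z‖ < 1 := by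
        rw [norm_mul, RCLike.norm_conj]
        exact mul_lt_one_of_nonneg_of_lt_one_left (norm_nonneg _) h0 (hb z hz)
      rw [← sub_eq_zero.1 h] at h1
      simp at h1
    set ψ : ℂ → ℂ := fun z => (g z - g 0) / (1 - conj (g 0) * g z) with hψ
    have hψd : DifferentiableOn ℂ ψ unitDisk := by
      refine DifferentiableOn.div (hd.sub_const _) ?_ hden
      exact (differentiableOn_const _).sub ((differentiableOn_const _).mul hd)
    have hψ0 : ψ 0 = 0 := by simp [hψ]
    have hψb : Set.MapsTo ψ unitDisk (Metric.closedBall (ψ 0) 1) := by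
      intro z hz
      rw [hψ0, mem_closedBall_zero_iff, hψ, norm_div, div_le_one (norm_pos_iff.2 (hden z hz)),
        ← sq_le_sq₀ (norm_nonneg _) (norm_nonneg _)]
      have hz1 : ‖g z‖ ^ 2 ≤ 1 := pow_le_one₀ (norm_nonneg _) (hb z hz)
      have h01 : ‖g 0‖ ^ 2 ≤ 1 := pow_le_one₀ (norm_nonneg _) h0.le
      rw [← Complex.normSq_eq_norm_sq, Complex.normSq_apply] at hz1 h01 ⊢
      rw [← Complex.normSq_eq_norm_sq, Complex.normSq_apply]
      simp only [Complex.sub_re, Complex.sub_im, Complex.mul_re, Complex.mul_im, Complex.one_re,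
        Complex.one_im, Complex.conj_re, Complex.conj_im]
      -- With `a = g 0` and `b = g z`: `|1 - conj a·b|² - |b - a|² = (1 - |a|²)(1 - |b|²)`.
      nlinarith [mul_nonneg (sub_nonneg.2 hz1) (sub_nonneg.2 h01)]
    refine ⟨dslope ψ 0, ?_, fun z hz => ?_, fun z hz => ?_⟩
    · exact (Complex.differentiableOn_dslope unitDisk_mem_nhds).2 hψd
    · simpa using Complex.norm_dslope_le_div_of_mapsTo_ball hψd hψb hz
    · have h := sub_smul_dslope ψ 0 z
      rw [hψ0, sub_zero, sub_zero, smul_eq_mul] at h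
      rw [← mul_assoc, h, hψ, div_mul_cancel₀ _ (hden z hz)]
      ring
  -- If `‖g 0‖ = 1`, the maximum principle makes `g` constant, so `s = 0` works.
  · refine ⟨fun _ => 0, differentiableOn_const _, by simp, fun z hz => ?_⟩
    have hmax : IsMaxOn (norm ∘ g) unitDisk 0 := isMaxOn_iff.2 fun z hz => by
      simpa [h0] using hb z hz
    have := Complex.eqOn_of_isPreconnected_of_isMaxOn_norm
      (convex_ball (0 : ℂ) 1).isPreconnected Metric.isOpen_ball hd zero_mem_unitDisk hmax hz
    simpa using this

/-- The coefficient form of one step of the Schur algorithm. -/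
lemma exists_schur_step_coeff {g : ℂ → ℂ} (hd : DifferentiableOn ℂ g unitDisk)
    (hb : ∀ z ∈ unitDisk, ‖g z‖ ≤ 1) :
    ∃ s : ℂ → ℂ, DifferentiableOn ℂ s unitDisk ∧ (∀ z ∈ unitDisk, ‖s z‖ ≤ 1) ∧
      coeff g 1 = s 0 * (1 - conj (g 0) * g 0) ∧
      coeff g 2 = coeff s 1 * (1 - conj (g 0) * g 0) - s 0 * (conj (g 0) * coeff g 1) := by
  obtain ⟨s, hsd, hsb, hs⟩ := exists_schur_step hd hb
  have hga := analyticAt_of_differentiableOn hd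
  have hsa := analyticAt_of_differentiableOn hsd
  have hca : AnalyticAt ℂ (fun z => 1 + -conj (g 0) * g z) 0 := by fun_prop
  have hpa : AnalyticAt ℂ (fun z => s z * (1 + -conj (g 0) * g z)) 0 := hsa.mul hca
  have heq : g =ᶠ[𝓝 0] fun z => g 0 + z * (s z * (1 + -conj (g 0) * g z)) := by
    filter_upwards [unitDisk_mem_nhds] with z hz
    rw [neg_mul, ← sub_eq_add_neg]
    exact hs z hz
  have hc : ∀ n, coeff (fun z => 1 + -conj (g 0) * g z) n =
      (if n = 0 then 1 else 0) - conj (g 0) * coeff g n := by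
    intro n
    rw [coeff_add analyticAt_const (by fun_prop), coeff_const, coeff_const_mul _ hga]
    ring
  have hstep : ∀ n, coeff g (n + 1) = coeff (fun z => s z * (1 + -conj (g 0) * g z)) n := by
    intro n
    rw [coeff_congr heq, coeff_add analyticAt_const (by fun_prop), coeff_const,
      coeff_id_mul_succ hpa]
    simp
  refine ⟨s, hsd, hsb, ?_, ?_⟩
  · rw [hstep, coeff_mul hsa hca]
    rw [Finset.sum_range_one, hc, coeff_zero, coeff_zero]
    simp
  · rw [hstep, coeff_mul hsa hca]
    rw [Finset.sum_range_succ, Finset.sum_range_one, hc, hc, coeff_zero, coeff_zero]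
    simp
    ring

lemma one_sub_conj_mul_self (z : ℂ) : 1 - conj z * z = ((1 - ‖z‖ ^ 2 : ℝ) : ℂ) := by
  rw [Complex.conj_mul']
  push_cast
  rfl

/-- `(c₁, c₂, c₃)` has the Schur parametrization of the first three coefficients of a function
bounded by one on the disk and vanishing at the origin. -/
def IsSchurTriple (c₁ c₂ c₃ : ℂ) : Prop :=
  ∃ x ξ : ℂ, ‖c₁‖ ≤ 1 ∧ ‖x‖ ≤ 1 ∧ ‖ξ‖ ≤ 1 ∧ c₂ = ((1 - ‖c₁‖ ^ 2 : ℝ) : ℂ) * x ∧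
    c₃ = ((1 - ‖c₁‖ ^ 2 : ℝ) : ℂ) * (((1 - ‖x‖ ^ 2 : ℝ) : ℂ) * ξ - conj c₁ * x ^ 2)

/-- By the Schwarz lemma `w(z)/z` is bounded by one. Two Schur steps applied to it produce `s`, then
`r`; the parameters are `x = s 0` and `ξ = r 0`. -/
lemma isSchurTriple_coeff {w : ℂ → ℂ} (hd : DifferentiableOn ℂ w unitDisk) (h0 : w 0 = 0)
    (hb : ∀ z ∈ unitDisk, ‖w z‖ < 1) : IsSchurTriple (coeff w 1) (coeff w 2) (coeff w 3) := by
  have hgd : DifferentiableOn ℂ (dslope w 0) unitDisk :=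
    (Complex.differentiableOn_dslope unitDisk_mem_nhds).2 hd
  have hgb : ∀ z ∈ unitDisk, ‖dslope w 0 z‖ ≤ 1 := by
    intro z hz
    have hmaps : Set.MapsTo w unitDisk (Metric.closedBall (w 0) 1) := by
      intro z hz
      rw [h0, mem_closedBall_zero_iff]
      exact (hb z hz).le
    simpa using Complex.norm_dslope_le_div_of_mapsTo_ball hd hmaps hz
  have hw : w = fun z => z * dslope w 0 z := by
    funext z
    have h := sub_smul_dslope w 0 z
    rw [h0, sub_zero, sub_zero, smul_eq_mul] at h
    exact h.symm
  have hc : ∀ n, coeff w (n + 1) = coeff (dslope w 0) n := by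
    intro n
    conv_lhs => rw [hw]
    exact coeff_id_mul_succ (analyticAt_of_differentiableOn hgd) n
  obtain ⟨s, hsd, hsb, hg1, hg2⟩ := exists_schur_step_coeff hgd hgb
  obtain ⟨r, hrd, hrb, hs1, -⟩ := exists_schur_step_coeff hsd hsb
  rw [hc, hc, hc, coeff_zero]
  refine ⟨s 0, r 0, hgb 0 zero_mem_unitDisk, hsb 0 zero_mem_unitDisk, hrb 0 zero_mem_unitDisk,
    ?_, ?_⟩
  · rw [hg1, one_sub_conj_mul_self, mul_comm]
  · rw [hg2, hg1, hs1, ← one_sub_conj_mul_self, ← one_sub_conj_mul_self]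
    ring

/-! ### Coefficients of Bazilevič functions -/

/-- The first coefficients of an analytic branch of a power. -/
lemma coeff_exp_const_mul {L : ℂ → ℂ} (hL : AnalyticAt ℂ L 0) (h0 : L 0 = 0) (c : ℂ) :
    coeff (fun z => Complex.exp (c * L z)) 0 = 1 ∧
    coeff (fun z => Complex.exp (c * L z)) 1 = c * coeff L 1 ∧
    coeff (fun z => Complex.exp (c * L z)) 2 = c * coeff L 2 + c ^ 2 * coeff L 1 ^ 2 / 2 ∧
    coeff (fun z => Complex.exp (c * L z)) 3 =
      c * coeff L 3 + c ^ 2 * coeff L 1 * coeff L 2 + c ^ 3 * coeff L 1 ^ 3 / 6 := by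
  set E : ℂ → ℂ := fun z => Complex.exp (c * L z) with hE
  have hEa : AnalyticAt ℂ E 0 := by fun_prop
  have hLd : AnalyticAt ℂ (deriv L) 0 := hL.deriv
  have hder : deriv E =ᶠ[𝓝 0] fun z => (c * deriv L z) * E z := by
    filter_upwards [hL.eventually_analyticAt] with z hz
    rw [hE, (hz.differentiableAt.hasDerivAt.const_mul c).cexp.deriv]
    ring
  have hrec : ∀ n : ℕ, ((n : ℂ) + 1) * coeff E (n + 1) =
      ∑ i ∈ Finset.range (n + 1), (c * ((i + 1) * coeff L (i + 1))) * coeff E (n - i) := by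
    intro n
    rw [← coeff_deriv, coeff_congr hder, coeff_mul (by fun_prop) hEa]
    refine Finset.sum_congr rfl fun i _ => ?_
    rw [coeff_const_mul _ hLd, coeff_deriv]
  have e0 : coeff E 0 = 1 := by simp [coeff_zero, hE, h0]
  have e1 := hrec 0
  have e2 := hrec 1
  have e3 := hrec 2
  norm_num [Finset.sum_range_succ, e0] at e1 e2 e3
  rw [e1] at e2 e3
  refine ⟨e0, e1, ?_, ?_⟩
  · linear_combination e2 / 2
  · linear_combination e3 / 3 + c * coeff L 1 * e2 / 6

/-- The coefficient relations for the Bazilevič subordination, in terms of the logarithm of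
`h(z) / z`. -/
lemma BazilevicSubordinate.exists_log {mu t : ℝ} {h : ℂ → ℂ}
    (hh : BazilevicSubordinate 1 mu t h) :
    ∃ L : ℂ → ℂ, AnalyticAt ℂ L 0 ∧ L 0 = 0 ∧ (∀ᶠ z in 𝓝 0, h z = z * Complex.exp (L z)) ∧
      ∃ c₁ c₂ c₃ : ℂ, IsSchurTriple c₁ c₂ c₃ ∧
        (1 + mu) * coeff L 1 = 2 * t * c₁ ∧
        (2 + mu) * (coeff L 2 + mu * coeff L 1 ^ 2 / 2) =
          2 * t * c₂ + (4 * t ^ 2 - 1) * c₁ ^ 2 ∧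
        (3 + mu) * (coeff L 3 + mu * coeff L 1 * coeff L 2 + mu ^ 2 * coeff L 1 ^ 3 / 6) =
          2 * t * c₃ + 2 * (4 * t ^ 2 - 1) * c₁ * c₂ + (8 * t ^ 3 - 4 * t) * c₁ ^ 3 := by
  obtain ⟨L, hLd, hL0, hhL, w, hwd, hw0, hwb, hw⟩ := hh
  have hL := analyticAt_of_differentiableOn hLd
  have hwa := analyticAt_of_differentiableOn hwd
  have hLda : AnalyticAt ℂ (deriv L) 0 := hL.deriv
  have hhe : ∀ᶠ z in 𝓝 0, h z = z * Complex.exp (L z) := by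
    filter_upwards [unitDisk_mem_nhds] with z hz using hhL z hz
  refine ⟨L, hL, hL0, hhe, _, _, _, isSchurTriple_coeff hwd hw0 hwb, ?_⟩
  set E : ℂ → ℂ := fun z => Complex.exp ((mu : ℂ) * L z) with hE
  have hEa : AnalyticAt ℂ E 0 := by fun_prop
  -- `Q` is the denominator of `G ∘ w`. The relation `F·Q = 1` is compared coefficientwise, which
  -- avoids expanding a reciprocal.
  set Q : ℂ → ℂ := fun z => 1 + (-(2 * (t : ℂ)) * w z + w z * w z) with hQ
  have hQa : AnalyticAt ℂ Q 0 := by fun_prop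
  set F : ℂ → ℂ := fun z => (1 + z * deriv L z) * E z with hF
  have hFa : AnalyticAt ℂ F 0 := by fun_prop
  have hFQ : (fun z => F z * Q z) =ᶠ[𝓝 0] fun _ => 1 := by
    have hQ0 : ∀ᶠ z in 𝓝 0, Q z ≠ 0 :=
      hQa.continuousAt.eventually_ne (by simp [hQ, hw0])
    filter_upwards [hQ0, hhe.eventually_nhds, hL.eventually_analyticAt, unitDisk_mem_nhds]
      with z hz hzh hzL hzd
    have hdh : deriv h z = Complex.exp (L z) + z * (Complex.exp (L z) * deriv L z) := by
      rw [EventuallyEq.deriv_eq hzh]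
      have := (hasDerivAt_id z).fun_mul hzL.differentiableAt.hasDerivAt.cexp
      simpa using this.deriv
    have key := hw z hzd
    dsimp only at key
    have hGQ : chebG t (w z) * Q z = 1 := by
      have : 1 - 2 * (t : ℂ) * w z + w z ^ 2 = Q z := by rw [hQ]; ring
      rw [chebG, this, one_div_mul_cancel hz]
    have hexp : Complex.exp (L z) * Complex.exp (((mu : ℂ) - 1) * L z) = E z := by
      rw [hE, ← Complex.exp_add]
      ring_nf
    have hFz : F z = chebG t (w z) := by
      rw [← key, hdh, hF]
      push_cast
      linear_combination (-1 - z * deriv L z) * hexp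
    rw [hFz, hGQ]
  have hprod : ∀ n, ∑ i ∈ Finset.range (n + 1), coeff F i * coeff Q (n - i) =
      if n = 0 then 1 else 0 := by
    intro n
    rw [← coeff_mul hFa hQa, coeff_congr hFQ, coeff_const]
  have hqn : ∀ n, coeff Q n = (if n = 0 then 1 else 0) + (-(2 * (t : ℂ)) * coeff w n +
      ∑ i ∈ Finset.range (n + 1), coeff w i * coeff w (n - i)) := by
    intro n
    rw [hQ, coeff_add analyticAt_const (by fun_prop), coeff_const,
      coeff_add (by fun_prop) (by fun_prop), coeff_const_mul _ hwa, coeff_mul hwa hwa]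
  obtain ⟨e0, e1, e2, e3⟩ := coeff_exp_const_mul hL hL0 mu
  rw [← hE] at e0 e1 e2 e3
  have hPa : AnalyticAt ℂ (fun z => z * deriv L z) 0 := by fun_prop
  have hpn : ∀ n, coeff (fun z => 1 + z * deriv L z) (n + 1) = (n + 1) * coeff L (n + 1) := by
    intro n
    rw [coeff_add analyticAt_const hPa, coeff_const, coeff_id_mul_succ hLda, coeff_deriv]
    simp
  have hp0 : coeff (fun z => 1 + z * deriv L z) 0 = 1 := by simp [coeff_zero]
  have hp1 := hpn 0
  have hp2 := hpn 1
  have hp3 := hpn 2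
  have hfn : ∀ n, coeff F n = ∑ i ∈ Finset.range (n + 1),
      coeff (fun z => 1 + z * deriv L z) i * coeff E (n - i) := by
    intro n
    rw [hF, coeff_mul (by fun_prop) hEa]
  have f0 := hfn 0
  have f1 := hfn 1
  have f2 := hfn 2
  have f3 := hfn 3
  have w0 : coeff w 0 = 0 := by rw [coeff_zero, hw0]
  have q0 := hqn 0
  have q1 := hqn 1
  have q2 := hqn 2
  have q3 := hqn 3
  have r1 := hprod 1
  have r2 := hprod 2
  have r3 := hprod 3
  generalize coeff (fun z => 1 + z * deriv L z) = p at *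
  norm_num [Finset.sum_range_succ, w0] at q0 q1 q2 q3
  norm_num [Finset.sum_range_succ, hp0, e0] at hp1 hp2 hp3 f0 f1 f2 f3
  norm_num [Finset.sum_range_succ, q0, f0] at r1 r2 r3
  rw [e1, hp1] at f1
  rw [e1, e2, hp1, hp2] at f2
  rw [e1, e2, e3, hp1, hp2, hp3] at f3
  rw [f1, q1] at r1
  rw [f1, f2, q1, q2] at r2
  rw [f1, f2, f3, q1, q2, q3] at r3
  -- Since `F - 1/Q = (1/Q)(F·Q - 1)`, the multipliers below are the Taylor coefficients of `1/Q`.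
  refine ⟨?_, ?_, ?_⟩
  · linear_combination r1
  · linear_combination r2 + 2 * t * coeff w 1 * r1
  · linear_combination r3 + 2 * t * coeff w 1 * r2 +
      (2 * t * coeff w 2 - coeff w 1 ^ 2 + 4 * t ^ 2 * coeff w 1 ^ 2) * r1

/-- The coefficients of `z exp(L(z))`. -/
lemma coeff_id_mul_exp {h L : ℂ → ℂ} (hL : AnalyticAt ℂ L 0) (h0 : L 0 = 0)
    (hh : ∀ᶠ z in 𝓝 0, h z = z * Complex.exp (L z)) :
    coeff h 2 = coeff L 1 ∧ coeff h 3 = coeff L 2 + coeff L 1 ^ 2 / 2 ∧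
      coeff h 4 = coeff L 3 + coeff L 1 * coeff L 2 + coeff L 1 ^ 3 / 6 := by
  obtain ⟨-, e1, e2, e3⟩ := coeff_exp_const_mul hL h0 1
  simp only [one_mul, one_pow] at e1 e2 e3
  have hc : ∀ n, coeff h (n + 1) = coeff (fun z => Complex.exp (L z)) n := by
    intro n
    rw [coeff_congr (g := fun z => z * Complex.exp (L z)) hh, coeff_id_mul_succ (by fun_prop)]
  exact ⟨(hc 1).trans e1, (hc 2).trans e2, (hc 3).trans e3⟩

/-- The relations between the logarithms of `h(z) / z` and `h⁻¹(w) / w`. -/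
lemma coeff_log_inverse {h k L M : ℂ → ℂ} (hL : AnalyticAt ℂ L 0) (hL0 : L 0 = 0)
    (hh : ∀ᶠ z in 𝓝 0, h z = z * Complex.exp (L z)) (hM : AnalyticAt ℂ M 0) (hM0 : M 0 = 0)
    (hk : ∀ᶠ z in 𝓝 0, k z = z * Complex.exp (M z)) (hkh : ∀ᶠ z in 𝓝 0, k (h z) = z) :
    coeff L 1 + coeff M 1 = 0 ∧ coeff L 2 + coeff M 1 * coeff L 1 + coeff M 2 = 0 ∧
      coeff L 3 + coeff M 1 * (coeff L 2 + coeff L 1 ^ 2 / 2) + 2 * coeff M 2 * coeff L 1 +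
        coeff M 3 = 0 := by
  set H : ℂ → ℂ := fun z => z * Complex.exp (L z) with hH
  have hHa : AnalyticAt ℂ H 0 := by fun_prop
  have hH0 : H 0 = 0 := by simp [hH]
  have hMH : AnalyticAt ℂ (fun z => M (H z)) 0 := by
    refine AnalyticAt.fun_comp ?_ hHa
    rwa [hH0]
  have hHt : Tendsto H (𝓝 0) (𝓝 0) := by simpa [hH0] using hHa.continuousAt.tendsto
  -- Cancelling `z` in `k(h(z)) = z` gives `exp(L + M ∘ H) = 1`. The exponent is continuous and
  -- vanishes at the origin, so it stays below `2π` in modulus nearby and must be the zero multiple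
  -- of `2πi`.
  have hzero : (fun z => L z + M (H z)) =ᶠ[𝓝 0] fun _ => 0 := by
    have hcont : ContinuousAt (fun z => L z + M (H z)) 0 := (hL.add hMH).continuousAt
    have hpi : ∀ᶠ z in 𝓝 0, ‖L z + M (H z)‖ < 2 * Real.pi := by
      refine hcont.norm.eventually_lt continuousAt_const ?_
      simp [hL0, hH0, hM0, Real.pi_pos]
    have hkH : ∀ᶠ z in 𝓝 0, k (H z) = H z * Complex.exp (M (H z)) := hHt.eventually hk
    have hne : ∀ᶠ z in 𝓝 0, z ≠ 0 → Complex.exp (L z + M (H z)) = 1 := by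
      filter_upwards [hkH, hkh, hh] with z h1 h2 h3 hz
      rw [h3, h1] at h2
      rw [Complex.exp_add]
      apply mul_left_cancel₀ hz
      linear_combination h2
    filter_upwards [hne, hpi] with z h1 h2
    rcases eq_or_ne z 0 with rfl | hz
    · simp [hL0, hH0, hM0]
    obtain ⟨n, hn⟩ := Complex.exp_eq_one_iff.1 (h1 hz)
    have hn0 : n = 0 := by
      rw [hn] at h2
      simp only [norm_mul, Complex.norm_intCast, Complex.norm_ofNat, Complex.norm_real,
        Complex.norm_I, mul_one, Real.norm_eq_abs, abs_of_pos Real.pi_pos] at h2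
      have : |(n : ℝ)| < 1 := by
        have := Real.two_pi_pos
        nlinarith
      exact Int.abs_lt_one_iff.1 (mod_cast this)
    rw [hn, hn0]
    simp
  -- Three divisions by the coordinate replace a general composition formula: since `H = z·E`, each
  -- stage reads `N ∘ H = N(0) + z·E·(N₁ ∘ H)`, where `N₁` is the quotient of `N - N(0)`.
  obtain ⟨M₁, hM₁, hM₁e⟩ := exists_analyticAt_eq_add_id_mul hM
  obtain ⟨M₂, hM₂, hM₂e⟩ := exists_analyticAt_eq_add_id_mul hM₁
  obtain ⟨M₃, hM₃, hM₃e⟩ := exists_analyticAt_eq_add_id_mul hM₂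
  have hdiv : ∀ {f g : ℂ → ℂ}, AnalyticAt ℂ g 0 → (∀ z, f z = f 0 + z * g z) → ∀ n,
      coeff f (n + 1) = coeff g n := by
    intro f g hg hfg n
    rw [coeff_congr (Eventually.of_forall hfg), coeff_add analyticAt_const (by fun_prop),
      coeff_const, coeff_id_mul_succ hg]
    simp
  have m1 : coeff M 1 = M₁ 0 := by rw [hdiv hM₁ hM₁e, coeff_zero]
  have m2 : coeff M 2 = M₂ 0 := by rw [hdiv hM₁ hM₁e, hdiv hM₂ hM₂e, coeff_zero]
  have m3 : coeff M 3 = M₃ 0 := by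
    rw [hdiv hM₁ hM₁e, hdiv hM₂ hM₂e, hdiv hM₃ hM₃e, coeff_zero]
  set E : ℂ → ℂ := fun z => Complex.exp (L z) with hE
  have hEa : AnalyticAt ℂ E 0 := by fun_prop
  obtain ⟨e0, e1, e2, -⟩ := coeff_exp_const_mul hL hL0 1
  simp only [one_mul, one_pow] at e0 e1 e2
  rw [← hE] at e0 e1 e2
  have hR : ∀ {N : ℂ → ℂ}, AnalyticAt ℂ N 0 → AnalyticAt ℂ (fun z => N (H z)) 0 := by
    intro N hN
    refine AnalyticAt.fun_comp ?_ hHa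
    rwa [hH0]
  have hstep : ∀ {f g : ℂ → ℂ}, AnalyticAt ℂ g 0 → (∀ z, f z = f 0 + z * g z) →
      ∀ n, coeff (fun z => f (H z)) (n + 1) =
        ∑ i ∈ Finset.range (n + 1), coeff E i * coeff (fun z => g (H z)) (n - i) := by
    intro f g hg hfg n
    have hgH := hR hg
    have heq : (fun z => f (H z)) =ᶠ[𝓝 0] fun z => f 0 + z * (E z * g (H z)) :=
      Eventually.of_forall fun z => by
        change f (H z) = f 0 + z * (E z * g (H z))
        rw [hfg (H z), hH]
        ring
    have hEg : AnalyticAt ℂ (fun z => E z * g (H z)) 0 := hEa.fun_mul hgH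
    rw [coeff_congr heq, coeff_add analyticAt_const (by fun_prop), coeff_const,
      coeff_id_mul_succ hEg, coeff_mul hEa hgH]
    simp
  have hsum : ∀ n, coeff L n + coeff (fun z => M (H z)) n = 0 := by
    intro n
    rw [← coeff_add hL hMH, coeff_congr hzero, coeff_const]
    simp
  have a1 := hstep hM₁ hM₁e 0
  have a2 := hstep hM₁ hM₁e 1
  have a3 := hstep hM₁ hM₁e 2
  have b1 := hstep hM₂ hM₂e 0
  have b2 := hstep hM₂ hM₂e 1
  have d1 := hstep hM₃ hM₃e 0
  have s1 := hsum 1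
  have s2 := hsum 2
  have s3 := hsum 3
  have z1 : coeff (fun z => M₁ (H z)) 0 = coeff M 1 := by rw [coeff_zero, hH0, m1]
  have z2 : coeff (fun z => M₂ (H z)) 0 = coeff M 2 := by rw [coeff_zero, hH0, m2]
  have z3 : coeff (fun z => M₃ (H z)) 0 = coeff M 3 := by rw [coeff_zero, hH0, m3]
  generalize coeff (fun z => M (H z)) = u at *
  generalize coeff (fun z => M₁ (H z)) = u₁ at *
  generalize coeff (fun z => M₂ (H z)) = u₂ at *
  generalize coeff (fun z => M₃ (H z)) = u₃ at *
  norm_num [Finset.sum_range_succ, e0, z1, z2, z3] at a1 a2 a3 b1 b2 d1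
  rw [a1] at s1
  rw [a2, b1, e1] at s2
  rw [a3, b2, b1, d1, e1, e2] at s3
  refine ⟨s1, ?_, ?_⟩
  · linear_combination s2
  · linear_combination s3

/-! ### The coefficients of `fDelta` -/

/-- The integrand in the definition of `fDelta`. -/
noncomputable def fDeltaKernel (delta : ℝ) (r : ℂ) : ℂ :=
  ((1 + r) / (1 - r)) ^ (delta : ℂ) * (1 / (1 - r ^ 2))

lemma one_sub_ne_zero_of_mem {r : ℂ} (hr : r ∈ unitDisk) : 1 - r ≠ 0 := by
  rintro h
  rw [unitDisk, mem_ball_zero_iff, ← sub_eq_zero.1 h] at hr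
  simp at hr

lemma one_add_ne_zero_of_mem {r : ℂ} (hr : r ∈ unitDisk) : 1 + r ≠ 0 := by
  have hr' : -r ∈ unitDisk := by simpa [unitDisk] using hr
  simpa using one_sub_ne_zero_of_mem hr'

lemma one_sub_sq_ne_zero_of_mem {r : ℂ} (hr : r ∈ unitDisk) : 1 - r ^ 2 ≠ 0 := by
  have : 1 - r ^ 2 = (1 - r) * (1 + r) := by ring
  rw [this]
  exact mul_ne_zero (one_sub_ne_zero_of_mem hr) (one_add_ne_zero_of_mem hr)

/-- The real part equals `(1 - |r|²)/|1 - r|² > 0`, so the principal power in the kernel is analytic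
on the disk. -/
lemma cayley_mem_slitPlane {r : ℂ} (hr : r ∈ unitDisk) :
    (1 + r) / (1 - r) ∈ Complex.slitPlane := by
  left
  have h1 := Complex.normSq_pos.2 (one_sub_ne_zero_of_mem hr)
  have h2 : ‖r‖ ^ 2 < 1 := by
    rw [unitDisk, mem_ball_zero_iff] at hr
    exact pow_lt_one₀ (norm_nonneg _) hr two_ne_zero
  rw [← Complex.normSq_eq_norm_sq, Complex.normSq_apply] at h2
  rw [Complex.div_re, ← add_div]
  apply div_pos _ h1
  simp only [Complex.add_re, Complex.sub_re, Complex.add_im, Complex.sub_im, Complex.one_re,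
    Complex.one_im]
  nlinarith

/-- The two factors have logarithmic derivatives `2δ/(1 - r²)` and `2r/(1 - r²)`. The resulting
linear equation determines the Taylor coefficients. -/
lemma hasDerivAt_fDeltaKernel (delta : ℝ) {r : ℂ} (hr : r ∈ unitDisk) :
    HasDerivAt (fDeltaKernel delta)
      ((2 * delta + 2 * r) / (1 - r ^ 2) * fDeltaKernel delta r) r := by
  have h1 := one_sub_ne_zero_of_mem hr
  have h2 := one_add_ne_zero_of_mem hr
  have h3 := one_sub_sq_ne_zero_of_mem hr
  have hs := cayley_mem_slitPlane hr
  have hq : HasDerivAt (fun r : ℂ => (1 + r) / (1 - r)) _ r :=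
    ((hasDerivAt_id r).const_add 1).fun_div ((hasDerivAt_id r).const_sub 1) h1
  have hp := hq.cpow_const (c := (delta : ℂ)) hs
  have hi : HasDerivAt (fun r : ℂ => 1 / (1 - r ^ 2)) _ r :=
    (hasDerivAt_const r (1 : ℂ)).fun_div (((hasDerivAt_id r).fun_pow 2).const_sub 1) h3
  refine (hp.fun_mul hi).congr_deriv ?_
  rw [fDeltaKernel, Complex.cpow_sub _ _ (div_ne_zero h2 h1), Complex.cpow_one]
  simp only [id]
  generalize ((1 + r) / (1 - r)) ^ (delta : ℂ) = u
  have h4 : 1 - r ^ 2 = (1 - r) * (1 + r) := by ring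
  rw [h4]
  field_simp
  ring

lemma differentiableOn_fDeltaKernel (delta : ℝ) :
    DifferentiableOn ℂ (fDeltaKernel delta) unitDisk := fun _ hr =>
  (hasDerivAt_fDeltaKernel delta hr).differentiableAt.differentiableWithinAt

/-- The kernel has a primitive on the disk, and the fundamental theorem of calculus along the
segment from `0` identifies `fDelta` with it up to a constant. -/
lemma hasDerivAt_fDelta (delta : ℝ) {z : ℂ} (hz : z ∈ unitDisk) :
    HasDerivAt (fDelta delta) (fDeltaKernel delta z) z := by
  obtain ⟨P, hP⟩ := (differentiableOn_fDeltaKernel delta).isExactOn_ball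
  have key : ∀ y ∈ unitDisk, fDelta delta y = P y - P 0 := by
    intro y hy
    have hmem : ∀ s ∈ Set.uIcc (0 : ℝ) 1, (s : ℂ) * y ∈ unitDisk := by
      intro s hs
      rw [Set.uIcc_of_le zero_le_one] at hs
      rw [unitDisk, mem_ball_zero_iff] at hy ⊢
      rw [norm_mul, Complex.norm_real, Real.norm_of_nonneg hs.1]
      exact (mul_le_of_le_one_left (norm_nonneg _) hs.2).trans_lt hy
    have hline : ∀ s : ℝ, HasDerivAt (fun s : ℝ => (s : ℂ) * y) y s := fun s => by
      simpa using (Complex.ofRealCLM.hasDerivAt (x := s)).mul_const y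
    have hd : ∀ s ∈ Set.uIcc (0 : ℝ) 1, HasDerivAt (fun s : ℝ => P ((s : ℂ) * y))
        (fDeltaKernel delta ((s : ℂ) * y) * y) s := fun s hs =>
      (hP _ (hmem s hs)).comp s (hline s)
    have hcont : ContinuousOn (fun s : ℝ => fDeltaKernel delta ((s : ℂ) * y) * y)
        (Set.uIcc (0 : ℝ) 1) := by
      refine ContinuousOn.mul ?_ continuousOn_const
      exact (differentiableOn_fDeltaKernel delta).continuousOn.comp
        (by fun_prop) hmem
    have := intervalIntegral.integral_eq_sub_of_hasDerivAt hd hcont.intervalIntegrable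
    simpa [fDelta, fDeltaKernel] using this
  refine ((hP z hz).sub_const (P 0)).congr_of_eventuallyEq ?_
  filter_upwards [Metric.isOpen_ball.mem_nhds hz] with y hy using key y hy

lemma differentiableOn_fDelta (delta : ℝ) : DifferentiableOn ℂ (fDelta delta) unitDisk :=
  fun _ hz => (hasDerivAt_fDelta delta hz).differentiableAt.differentiableWithinAt

/-- The equation `(1 - z²)K' = (2δ + 2z)K` gives `(n+1)k_{n+1} = 2δ k_n + (n+1)k_{n-1}` with `k₀ =
1`; integrating divides `k_n` by `n + 1`. -/
lemma coeff_fDelta (delta : ℝ) :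
    coeff (fDelta delta) 2 = delta ∧ coeff (fDelta delta) 3 = (2 * delta ^ 2 + 1) / 3 ∧
      coeff (fDelta delta) 4 = (delta ^ 3 + 2 * delta) / 3 := by
  have hK := analyticAt_of_differentiableOn (differentiableOn_fDeltaKernel delta)
  have hderiv : deriv (fDelta delta) =ᶠ[𝓝 0] fDeltaKernel delta := by
    filter_upwards [unitDisk_mem_nhds] with z hz using (hasDerivAt_fDelta delta hz).deriv
  have hc : ∀ n : ℕ, ((n : ℂ) + 1) * coeff (fDelta delta) (n + 1) =
      coeff (fDeltaKernel delta) n := by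
    intro n
    rw [← coeff_deriv, coeff_congr hderiv]
  set K := fDeltaKernel delta with hKdef
  have hKd : AnalyticAt ℂ (deriv K) 0 := hK.deriv
  have hode : deriv K =ᶠ[𝓝 0] fun z => z * (z * deriv K z) + (2 * delta * K z + 2 * (z * K z)) := by
    filter_upwards [unitDisk_mem_nhds] with z hz
    rw [hKdef, (hasDerivAt_fDeltaKernel delta hz).deriv]
    field_simp [one_sub_sq_ne_zero_of_mem hz]
    ring
  have hz1 : AnalyticAt ℂ (fun z => z * deriv K z) 0 := by fun_prop
  have hz2 : AnalyticAt ℂ (fun z => z * (z * deriv K z)) 0 := by fun_prop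
  have hz3 : AnalyticAt ℂ (fun z => z * K z) 0 := by fun_prop
  have hrec : ∀ n : ℕ, ((n : ℂ) + 1) * coeff K (n + 1) =
      coeff (fun z => z * (z * deriv K z)) n +
        (2 * delta * coeff K n + 2 * coeff (fun z => z * K z) n) := by
    intro n
    rw [← coeff_deriv, coeff_congr hode, coeff_add hz2 (by fun_prop),
      coeff_add (by fun_prop) (by fun_prop), coeff_const_mul _ hK, coeff_const_mul _ hz3]
  have k0 : coeff K 0 = 1 := by simp [coeff_zero, hKdef, fDeltaKernel]
  have k1 := hrec 0
  have k2 := hrec 1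
  have k3 := hrec 2
  rw [coeff_id_mul_zero, coeff_id_mul_zero, k0] at k1
  rw [coeff_id_mul_succ hz1, coeff_id_mul_zero, coeff_id_mul_succ hK, k0] at k2
  rw [coeff_id_mul_succ hz1, coeff_id_mul_succ hKd, coeff_id_mul_succ hK, coeff_deriv] at k3
  have c1 := hc 1
  have c2 := hc 2
  have c3 := hc 3
  norm_num at k1 k2 k3 c1 c2 c3
  rw [k1] at k2 k3 c1
  refine ⟨?_, ?_, ?_⟩
  · linear_combination c1 / 2
  · linear_combination c2 / 3 + k2 / 6
  · linear_combination c3 / 4 + k3 / 12 + delta * k2 / 12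

/-! ### Coefficients of a Hadamard product -/

/-- The Taylor series converges at `1/2`, so its terms there are bounded. -/
lemma exists_norm_coeff_le {f : ℂ → ℂ} (hf : DifferentiableOn ℂ f unitDisk) :
    ∃ C, ∀ n, ‖coeff f n‖ ≤ C * 2 ^ n := by
  have hmem : (1 / 2 : ℂ) ∈ Metric.ball (0 : ℂ) 1 := by
    rw [mem_ball_zero_iff]
    norm_num
  have hs := (Complex.hasSum_taylorSeries_on_ball hf hmem).summable.tendsto_atTop_zero
  obtain ⟨C, hC⟩ := hs.norm.bddAbove_range
  refine ⟨C, fun n => ?_⟩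
  have h := hC ⟨n, rfl⟩
  simp only [sub_zero, smul_eq_mul] at h
  have heq : ((n.factorial : ℂ))⁻¹ * ((1 / 2) ^ n * iteratedDeriv n f 0) =
      coeff f n / 2 ^ n := by
    rw [coeff, div_pow, one_pow]
    ring
  rw [heq, norm_div, norm_pow, Complex.norm_ofNat, div_le_iff₀ (by positivity)] at h
  exact h

/-- The product is defined by a pointwise sum. Bounding its coefficients by `A·B·4ⁿ` makes it a
convergent power series for `|z| < 1/4`, and uniqueness of expansions identifies the coefficients.
-/
lemma coeff_hadamard {f g : ℂ → ℂ} (hf : DifferentiableOn ℂ f unitDisk)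
    (hg : DifferentiableOn ℂ g unitDisk) (n : ℕ) :
    coeff (hadamard f g) n = coeff f n * coeff g n := by
  obtain ⟨A, hA⟩ := exists_norm_coeff_le hf
  obtain ⟨B, hB⟩ := exists_norm_coeff_le hg
  set a : ℕ → ℂ := fun n => coeff f n * coeff g n with ha
  have hseries : HasFPowerSeriesAt (hadamard f g) (FormalMultilinearSeries.ofScalars ℂ a) 0 := by
    rw [hasFPowerSeriesAt_iff]
    have hball : Metric.ball (0 : ℂ) (1 / 4) ∈ 𝓝 0 := Metric.ball_mem_nhds _ (by norm_num)
    filter_upwards [hball] with z hz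
    rw [mem_ball_zero_iff] at hz
    simp only [FormalMultilinearSeries.coeff_ofScalars, zero_add, smul_eq_mul]
    have hsum : Summable fun n => a n * z ^ n := by
      have hgeo : Summable fun n : ℕ => A * B * (4 * ‖z‖) ^ n :=
        (summable_geometric_of_lt_one (by positivity) (by linarith)).mul_left _
      refine Summable.of_norm_bounded hgeo fun n => ?_
      have hA0 : 0 ≤ A * 2 ^ n := (norm_nonneg _).trans (hA n)
      calc ‖a n * z ^ n‖ = ‖coeff f n‖ * ‖coeff g n‖ * ‖z‖ ^ n := by
            rw [ha, norm_mul, norm_mul, norm_pow]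
        _ ≤ (A * 2 ^ n) * (B * 2 ^ n) * ‖z‖ ^ n := by
            gcongr
            exacts [hA n, hB n]
        _ = A * B * (4 * ‖z‖) ^ n := by
            have h4 : (4 : ℝ) ^ n = 2 ^ n * 2 ^ n := by rw [← mul_pow]; norm_num
            rw [mul_pow, h4]
            ring
    have := hsum.hasSum
    simp_rw [mul_comm (a _)] at this ⊢
    convert! this using 1
    simp [hadamard, ha, mul_comm]
  have hcoeff := hseries.eq_formalMultilinearSeries hseries.analyticAt.hasFPowerSeriesAt
  have := congrArg (fun p => FormalMultilinearSeries.coeff p n) hcoeff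
  simpa [FormalMultilinearSeries.coeff_ofScalars, coeff, ha] using this.symm

lemma coeff_hadamard_fDelta {f h : ℂ → ℂ} {delta : ℝ} (hdelta : 1 ≤ delta)
    (hf : DifferentiableOn ℂ f unitDisk)
    (hconv : Set.EqOn h (hadamard f (fDelta delta)) unitDisk) :
    coeff f 2 = coeff h 2 / delta ∧ coeff f 3 = 3 * coeff h 3 / (2 * delta ^ 2 + 1) ∧
      coeff f 4 = 3 * coeff h 4 / (delta ^ 3 + 2 * delta) := by
  have hc : ∀ n, coeff h n = coeff f n * coeff (fDelta delta) n := by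
    intro n
    rw [← coeff_hadamard hf (differentiableOn_fDelta delta)]
    exact coeff_congr (hconv.eventuallyEq_of_mem unitDisk_mem_nhds) n
  obtain ⟨b2, b3, b4⟩ := coeff_fDelta delta
  have h2 : (delta : ℂ) ≠ 0 := by
    have : delta ≠ 0 := by positivity
    exact_mod_cast this
  have h3 : 2 * (delta : ℂ) ^ 2 + 1 ≠ 0 := by
    have : 2 * delta ^ 2 + 1 ≠ 0 := by positivity
    exact_mod_cast this
  have h4 : (delta : ℂ) ^ 3 + 2 * delta ≠ 0 := by
    have : delta ^ 3 + 2 * delta ≠ 0 := by positivity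
    exact_mod_cast this
  rw [hc, hc, hc, b2, b3, b4]
  exact ⟨by rw [eq_div_iff h2], by rw [eq_div_iff h3]; ring, by rw [eq_div_iff h4]; ring⟩

/-! ### The Hankel determinant -/

lemma chebU_one (t : ℝ) : chebU 1 t = 2 * t := by simp [chebU]

lemma chebU_two (t : ℝ) : chebU 2 t = 4 * t ^ 2 - 1 := by
  simp [chebU, Polynomial.Chebyshev.U_two]

lemma chebU_three (t : ℝ) : chebU 3 t = 8 * t ^ 3 - 4 * t := by
  have h := Polynomial.Chebyshev.U_add_two ℝ 1
  norm_num at h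
  simp only [chebU, Nat.cast_ofNat, h, Polynomial.Chebyshev.U_two]
  simp
  ring

/-- The coefficients of a Bazilevič function in terms of the Schwarz functions attached to it and
to its inverse. -/
lemma coeff_of_log_relations {m t : ℝ} (hm : 0 ≤ m) (ht : 0 < t)
    {l₁ l₂ l₃ m₁ m₂ m₃ c₁ c₂ c₃ d₁ d₂ d₃ : ℂ}
    (hc₁ : (1 + m) * l₁ = 2 * t * c₁)
    (hc₂ : (2 + m) * (l₂ + m * l₁ ^ 2 / 2) = 2 * t * c₂ + (4 * t ^ 2 - 1) * c₁ ^ 2)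
    (hc₃ : (3 + m) * (l₃ + m * l₁ * l₂ + m ^ 2 * l₁ ^ 3 / 6) =
      2 * t * c₃ + 2 * (4 * t ^ 2 - 1) * c₁ * c₂ + (8 * t ^ 3 - 4 * t) * c₁ ^ 3)
    (hd₁ : (1 + m) * m₁ = 2 * t * d₁)
    (hd₂ : (2 + m) * (m₂ + m * m₁ ^ 2 / 2) = 2 * t * d₂ + (4 * t ^ 2 - 1) * d₁ ^ 2)
    (hd₃ : (3 + m) * (m₃ + m * m₁ * m₂ + m ^ 2 * m₁ ^ 3 / 6) =
      2 * t * d₃ + 2 * (4 * t ^ 2 - 1) * d₁ * d₂ + (8 * t ^ 3 - 4 * t) * d₁ ^ 3)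
    (h₁ : l₁ + m₁ = 0) (h₂ : l₂ + m₁ * l₁ + m₂ = 0)
    (h₃ : l₃ + m₁ * (l₂ + l₁ ^ 2 / 2) + 2 * m₂ * l₁ + m₃ = 0) :
    d₁ = -c₁ ∧ l₁ = 2 * t * c₁ / (1 + m) ∧
      l₂ + l₁ ^ 2 / 2 = l₁ ^ 2 + t * (c₂ - d₂) / (2 + m) ∧
      l₃ + l₁ * l₂ + l₁ ^ 3 / 6 = -(m ^ 2 + 3 * m - 4) / 6 * l₁ ^ 3 +
        5 * l₁ * (t * (c₂ - d₂) / (2 + m)) / 2 +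
        (t * (c₃ - d₃) + (4 * t ^ 2 - 1) * c₁ * (c₂ + d₂) + (8 * t ^ 3 - 4 * t) * c₁ ^ 3) /
          (3 + m) := by
  have ht' : (t : ℂ) ≠ 0 := mod_cast ht.ne'
  have e1 : 1 + (m : ℂ) ≠ 0 := by
    have : 1 + m ≠ 0 := by positivity
    exact_mod_cast this
  have e2 : 2 + (m : ℂ) ≠ 0 := by
    have : 2 + m ≠ 0 := by positivity
    exact_mod_cast this
  have e3 : 3 + (m : ℂ) ≠ 0 := by
    have : 3 + m ≠ 0 := by positivity
    exact_mod_cast this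
  obtain rfl : m₁ = -l₁ := by linear_combination h₁
  obtain rfl : m₂ = l₁ ^ 2 - l₂ := by linear_combination h₂
  obtain rfl : m₃ = -(l₃ - 3 * l₁ * l₂ + 3 / 2 * l₁ ^ 3) := by linear_combination h₃
  obtain rfl : d₁ = -c₁ := by
    apply mul_left_cancel₀ (mul_ne_zero two_ne_zero ht')
    linear_combination -hc₁ - hd₁
  -- Half the difference of the second-order equations: the terms in `l₁²` and `c₁²` occur in both
  -- and cancel. `hY` treats the third-order equations alike.
  have hX : t * (c₂ - d₂) / (2 + m) = l₂ - l₁ ^ 2 / 2 := by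
    rw [div_eq_iff e2]
    linear_combination -hc₂ / 2 + hd₂ / 2
  have hY : (t * (c₃ - d₃) + (4 * t ^ 2 - 1) * c₁ * (c₂ + d₂) + (8 * t ^ 3 - 4 * t) * c₁ ^ 3) /
      (3 + m) = l₃ - 3 / 2 * l₁ * l₂ + 3 / 4 * l₁ ^ 3 + m * l₁ ^ 3 / 2 + m ^ 2 * l₁ ^ 3 / 6 := by
    rw [div_eq_iff e3]
    linear_combination -hc₃ / 2 + hd₃ / 2
  refine ⟨rfl, ?_, ?_, ?_⟩
  · rw [eq_div_iff e1]
    linear_combination hc₁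
  · rw [hX]
    ring
  · rw [hX, hY]
    ring

/-- The Hankel determinant as a polynomial in the Schwarz coefficients; `D` and `E` stand for
`δ (δ³ + 2 δ)` and `(2 δ² + 1)²`. -/
lemma hankel_identity {m t D E c₁ c₂ c₃ d₂ d₃ A₂ A₃ A₄ : ℂ}
    (e1 : 1 + m ≠ 0) (e2 : 2 + m ≠ 0) (e3 : 3 + m ≠ 0) (hD : D ≠ 0) (hE : E ≠ 0)
    (h₂ : A₂ = 2 * t * c₁ / (1 + m)) (h₃ : A₃ = A₂ ^ 2 + t * (c₂ - d₂) / (2 + m))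
    (h₄ : A₄ = -(m ^ 2 + 3 * m - 4) / 6 * A₂ ^ 3 + 5 * A₂ * (t * (c₂ - d₂) / (2 + m)) / 2 +
        (t * (c₃ - d₃) + (4 * t ^ 2 - 1) * c₁ * (c₂ + d₂) + (8 * t ^ 3 - 4 * t) * c₁ ^ 3) /
          (3 + m)) :
    3 * (A₂ * A₄) / D - 9 * A₃ ^ 2 / E =
      2 * t * (18 * E * (1 + m) ^ 3 * (8 * t ^ 3 - 4 * t) -
        (2 * t) ^ 3 * (3 + m) * (3 * E * (m ^ 2 + 3 * m - 4) + 54 * D)) /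
          (6 * D * E * (3 + m) * (1 + m) ^ 4) * c₁ ^ 4 +
      6 * (5 * E - 12 * D) * t ^ 3 / (D * E * (1 + m) ^ 2 * (2 + m)) * (c₁ ^ 2 * (c₂ - d₂)) +
      6 * t * (4 * t ^ 2 - 1) / (D * (1 + m) * (3 + m)) * (c₁ ^ 2 * (c₂ + d₂)) +
      6 * t ^ 2 / (D * (1 + m) * (3 + m)) * (c₁ * (c₃ - d₃)) -
      9 * t ^ 2 / (E * (2 + m) ^ 2) * (c₂ - d₂) ^ 2 := by
  rw [h₃, h₄, h₂]
  field_simp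
  ring

/-- The majorant of the Hankel determinant increases in the moduli of the free parameters. -/
lemma majorant_le {al be ep ka p X Y : ℝ} (hal : 0 ≤ al) (hbe : 0 ≤ be) (hep : 0 ≤ ep)
    (hka : ep / 4 ≤ ka) (hp : 0 ≤ p) (hp1 : p ≤ 1) (hX : 0 ≤ X) (hX1 : X ≤ 1) (hY : 0 ≤ Y)
    (hY1 : Y ≤ 1) :
    al * (p ^ 2 * ((1 - p ^ 2) * (X + Y))) + be * (p ^ 2 * ((1 - p ^ 2) * (X + Y))) +
      ep * (p * ((1 - p ^ 2) * (1 - X ^ 2 + p * X ^ 2) + (1 - p ^ 2) * (1 - Y ^ 2 + p * Y ^ 2))) +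
      ka * ((1 - p ^ 2) * (X + Y)) ^ 2 ≤
    2 * (al + be + ep) * p ^ 2 * (1 - p ^ 2) + 4 * ka * (1 - p ^ 2) ^ 2 := by
  have hq : 0 ≤ 1 - p ^ 2 := by nlinarith
  have hS : 0 ≤ 4 - (X + Y) ^ 2 := by nlinarith
  have h1 : 0 ≤ (al + be) * p ^ 2 * (2 - X - Y) := by
    have : 0 ≤ 2 - X - Y := by linarith
    positivity
  -- The `ep` term alone decreases in `X` and `Y`; the `ka` term compensates, since `ka(1 + p) ≥
  -- ep(1 + p)/4 ≥ ep·p/2`. The two sides of the claim differ by exactly `1 - p²` times the sum of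
  -- `h1` and `h4`.
  have h2 : 0 ≤ (ka * (1 + p) - ep * p / 2) * (4 - (X + Y) ^ 2) :=
    mul_nonneg (by nlinarith) hS
  have h3 : 0 ≤ ep * p * (X - Y) ^ 2 / 2 := by positivity
  have h4 : 0 ≤ (1 - p) * ((ka * (1 + p) - ep * p / 2) * (4 - (X + Y) ^ 2) +
      ep * p * (X - Y) ^ 2 / 2) := mul_nonneg (by linarith) (add_nonneg h2 h3)
  nlinarith [mul_nonneg hq (add_nonneg h1 h4)]

lemma norm_schur_second {p : ℝ} (hp : 0 ≤ p) (hp1 : p ≤ 1) (x y : ℂ) :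
    ‖((1 - p ^ 2 : ℝ) : ℂ) * x - ((1 - p ^ 2 : ℝ) : ℂ) * y‖ ≤ (1 - p ^ 2) * (‖x‖ + ‖y‖) ∧
      ‖((1 - p ^ 2 : ℝ) : ℂ) * x + ((1 - p ^ 2 : ℝ) : ℂ) * y‖ ≤ (1 - p ^ 2) * (‖x‖ + ‖y‖) := by
  have hq : 0 ≤ 1 - p ^ 2 := by nlinarith
  rw [← mul_sub, ← mul_add, norm_mul, norm_mul, Complex.norm_real, Real.norm_of_nonneg hq]
  exact ⟨mul_le_mul_of_nonneg_left (norm_sub_le _ _) hq,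
    mul_le_mul_of_nonneg_left (norm_add_le _ _) hq⟩

lemma norm_schur_third {c x ξ : ℂ} (hc : ‖c‖ ≤ 1) (hx : ‖x‖ ≤ 1) (hξ : ‖ξ‖ ≤ 1) :
    ‖((1 - ‖c‖ ^ 2 : ℝ) : ℂ) * (((1 - ‖x‖ ^ 2 : ℝ) : ℂ) * ξ - conj c * x ^ 2)‖ ≤
      (1 - ‖c‖ ^ 2) * (1 - ‖x‖ ^ 2 + ‖c‖ * ‖x‖ ^ 2) := by
  have hq : 0 ≤ 1 - ‖c‖ ^ 2 := sub_nonneg.2 (pow_le_one₀ (norm_nonneg _) hc)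
  have hr : 0 ≤ 1 - ‖x‖ ^ 2 := sub_nonneg.2 (pow_le_one₀ (norm_nonneg _) hx)
  rw [norm_mul, Complex.norm_real, Real.norm_of_nonneg hq]
  refine mul_le_mul_of_nonneg_left ((norm_sub_le _ _).trans ?_) hq
  rw [norm_mul, norm_mul, Complex.norm_real, Real.norm_of_nonneg hr, RCLike.norm_conj, norm_pow]
  gcongr
  exact mul_le_of_le_one_right hr hξ

/-- The triangle inequality for the Hankel functional. -/
lemma norm_hankel_functional_le {ta al be ep ka : ℝ} (hal : 0 ≤ al) (hbe : 0 ≤ be) (hep : 0 ≤ ep)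
    (hka : ep / 4 ≤ ka) {c₁ c₂ c₃ d₂ d₃ : ℂ} (hc : IsSchurTriple c₁ c₂ c₃)
    (hd : IsSchurTriple (-c₁) d₂ d₃) :
    ‖(ta : ℂ) * c₁ ^ 4 + al * (c₁ ^ 2 * (c₂ - d₂)) + be * (c₁ ^ 2 * (c₂ + d₂)) +
        ep * (c₁ * (c₃ - d₃)) - ka * (c₂ - d₂) ^ 2‖ ≤
      |ta| * ‖c₁‖ ^ 4 + (2 * (al + be + ep) * ‖c₁‖ ^ 2 * (1 - ‖c₁‖ ^ 2) +
        4 * ka * (1 - ‖c₁‖ ^ 2) ^ 2) := by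
  obtain ⟨x, ξ, hc1, hx, hξ, rfl, rfl⟩ := hc
  obtain ⟨y, η, hc1', hy, hη, hd2, hd3⟩ := hd
  have t3 := norm_schur_third hc1 hx hξ
  have t3' := norm_schur_third hc1' hy hη
  rw [← hd3] at t3'
  rw [norm_neg] at hd2 t3'
  obtain ⟨t2, t2'⟩ := norm_schur_second (norm_nonneg c₁) hc1 x y
  rw [← hd2] at t2 t2'
  have hka0 : 0 ≤ ka := by linarith
  refine le_trans ?_ (add_le_add_right (majorant_le hal hbe hep hka (norm_nonneg c₁) hc1
    (norm_nonneg x) hx (norm_nonneg y) hy) (|ta| * ‖c₁‖ ^ 4))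
  generalize ((1 - ‖c₁‖ ^ 2 : ℝ) : ℂ) * (((1 - ‖x‖ ^ 2 : ℝ) : ℂ) * ξ - conj c₁ * x ^ 2) = c₃ at *
  generalize ((1 - ‖c₁‖ ^ 2 : ℝ) : ℂ) * x = c₂ at *
  rw [← add_assoc, ← add_assoc, ← add_assoc]
  refine (norm_sub_le _ _).trans (add_le_add ((norm_add_le _ _).trans (add_le_add
    ((norm_add_le _ _).trans (add_le_add ((norm_add_le _ _).trans (add_le_add ?_ ?_)) ?_)) ?_)) ?_)
  · rw [norm_mul, norm_pow, Complex.norm_real, Real.norm_eq_abs]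
  · rw [norm_mul, norm_mul, norm_pow, Complex.norm_real, Real.norm_of_nonneg hal]
    gcongr
  · rw [norm_mul, norm_mul, norm_pow, Complex.norm_real, Real.norm_of_nonneg hbe]
    gcongr
  · rw [norm_mul, norm_mul, Complex.norm_real, Real.norm_of_nonneg hep]
    gcongr
    exact (norm_sub_le _ _).trans (add_le_add t3 t3')
  · rw [norm_mul, norm_pow, Complex.norm_real, Real.norm_of_nonneg hka0]
    gcongr

/-- The maximized majorant as a quadratic polynomial in `P = ‖c₁‖²`. -/
lemma majorant_eq {m t D E W P chi5 chi6 : ℝ} (hm : 0 ≤ m) (hD : 0 < D) (hE : 0 < E)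
    (h5 : chi5 = (2 + m) ^ 2 * (2 * t) * W +
      18 * (1 + m) ^ 3 * (3 * D * (1 + m) * (3 + m) - E * (2 + m) ^ 2) * (2 * t) ^ 2 -
      9 * (1 + m) ^ 2 * (2 + m) * (2 * t) * ((3 + m) * (5 * E - 12 * D) * (2 * t) ^ 2 +
        4 * E * (2 + m) * (1 + m) * (4 * t ^ 2 - 1)))
    (h6 : chi6 = ((2 + m) * (3 + m) * (5 * E - 12 * D) * (2 * t) ^ 3 +
      4 * E * (1 + m) * (2 + m) ^ 2 * (2 * t) * (4 * t ^ 2 - 1) +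
      (1 + m) * (2 * t) ^ 2 * (2 * E * (2 + m) ^ 2 - 12 * D * (1 + m) * (3 + m))) *
        (1 + m) ^ 2) :
    2 * t * W / (6 * D * E * (3 + m) * (1 + m) ^ 4) * P ^ 2 +
      (2 * (6 * (5 * E - 12 * D) * t ^ 3 / (D * E * (1 + m) ^ 2 * (2 + m)) +
        6 * t * (4 * t ^ 2 - 1) / (D * (1 + m) * (3 + m)) + 6 * t ^ 2 / (D * (1 + m) * (3 + m))) *
          P * (1 - P) + 4 * (9 * t ^ 2 / (E * (2 + m) ^ 2)) * (1 - P) ^ 2) =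
    36 * t ^ 2 / (E * (2 + m) ^ 2) +
      (9 * chi6 * P + chi5 * P ^ 2) / (6 * D * E * (3 + m) * (2 + m) ^ 2 * (1 + m) ^ 4) := by
  have e1 : 1 + m ≠ 0 := by positivity
  have e2 : 2 + m ≠ 0 := by positivity
  have e3 : 3 + m ≠ 0 := by positivity
  rw [h5, h6]
  field_simp
  ring

/-- The common denominator in `phiTwo` and `phiCrit`. -/
noncomputable def hankelDenom (mu delta : ℝ) : ℝ :=
  6 * (delta * (delta ^ 3 + 2 * delta)) * (2 * delta ^ 2 + 1) ^ 2 * (3 + mu) * (2 + mu) ^ 2 *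
    (1 + mu) ^ 4

lemma hankelDenom_pos {mu delta : ℝ} (hmu : 0 ≤ mu) (hdelta : 1 ≤ delta) :
    0 < hankelDenom mu delta := by
  have : 0 < delta := by linarith
  unfold hankelDenom
  positivity

/-- The Hankel determinant is bounded by a value on `[0, 1]` of a quadratic polynomial with
coefficients `chi5` and `chi6`. -/
theorem exists_hankel_le {mu delta t : ℝ} (hmu : 0 ≤ mu) (hdelta : 1 ≤ delta) (ht : 1 / 2 < t)
    {f h : ℂ → ℂ} (hf : f ∈ classA) (hconv : Set.EqOn h (hadamard f (fDelta delta)) unitDisk)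
    (hB : h ∈ classB mu delta t) :
    ∃ P : ℝ, 0 ≤ P ∧ P ≤ 1 ∧ ‖coeff f 2 * coeff f 4 - coeff f 3 ^ 2‖ ≤
      36 * t ^ 2 / ((2 * delta ^ 2 + 1) ^ 2 * (2 + mu) ^ 2) +
        (9 * chi6 mu delta t * P + chi5 mu delta t * P ^ 2) / hankelDenom mu delta := by
  obtain ⟨-, -, hbh, k, ⟨-, -, hkh⟩, hbk⟩ := hB
  obtain ⟨L, hL, hL0, hhL, c₁, c₂, c₃, hc, hc1, hc2, hc3⟩ := hbh.exists_log
  obtain ⟨M, hM, hM0, hkM, d₁, d₂, d₃, hd, hd1, hd2, hd3⟩ := hbk.exists_log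
  obtain ⟨h1, h2, h3⟩ := coeff_log_inverse hL hL0 hhL hM hM0 hkM hkh
  obtain ⟨rfl, A2, A3, A4⟩ :=
    coeff_of_log_relations hmu (by linarith) hc1 hc2 hc3 hd1 hd2 hd3 h1 h2 h3
  obtain ⟨a2, a3, a4⟩ := coeff_hadamard_fDelta hdelta hf.1 hconv
  obtain ⟨b2, b3, b4⟩ := coeff_id_mul_exp hL hL0 hhL
  rw [← b3, ← b2] at A3
  rw [← b4, ← b2] at A4
  rw [← b2] at A2
  have hδ : 0 < delta := by linarith
  have ht0 : 0 < t := by linarith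
  obtain ⟨D, hD⟩ : ∃ D, D = delta * (delta ^ 3 + 2 * delta) := ⟨_, rfl⟩
  obtain ⟨E, hE⟩ : ∃ E, E = (2 * delta ^ 2 + 1) ^ 2 := ⟨_, rfl⟩
  have hD0 : 0 < D := by rw [hD]; positivity
  have hE0 : 0 < E := by rw [hE]; positivity
  -- This is the factor `8δ⁴ - 4δ² + 5` of `χ₁` and `χ₂`.
  have hDE : 0 ≤ 5 * E - 12 * D := by
    rw [hD, hE]
    nlinarith [sq_nonneg (delta ^ 2 - 1), mul_self_nonneg delta]
  have hED : E ≤ 4 * D := by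
    rw [hD, hE]
    nlinarith
  -- `t > 1/2` makes `U₂(t)` nonnegative, so the coefficient `be` below is nonnegative.
  have hU2 : 0 ≤ 4 * t ^ 2 - 1 := by nlinarith
  have c1 : 1 + (mu : ℂ) ≠ 0 := by
    have : 1 + mu ≠ 0 := by positivity
    exact_mod_cast this
  have c2 : 2 + (mu : ℂ) ≠ 0 := by
    have : 2 + mu ≠ 0 := by positivity
    exact_mod_cast this
  have c3 : 3 + (mu : ℂ) ≠ 0 := by
    have : 3 + mu ≠ 0 := by positivity
    exact_mod_cast this
  have cD : (D : ℂ) ≠ 0 := mod_cast hD0.ne'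
  have cE : (E : ℂ) ≠ 0 := mod_cast hE0.ne'
  have hid := hankel_identity c1 c2 c3 cD cE A2 A3 A4
  have hΩ : Omega 1 mu delta t = 18 * E * (1 + mu) ^ 3 * (8 * t ^ 3 - 4 * t) -
      (2 * t) ^ 3 * (3 + mu) * (3 * E * (mu ^ 2 + 3 * mu - 4) + 54 * D) := by
    rw [Omega, chebU_one, chebU_three, hD, hE]
    ring
  have h5 : chi5 mu delta t = (2 + mu) ^ 2 * (2 * t) * |Omega 1 mu delta t| +
      18 * (1 + mu) ^ 3 * (3 * D * (1 + mu) * (3 + mu) - E * (2 + mu) ^ 2) * (2 * t) ^ 2 -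
      9 * (1 + mu) ^ 2 * (2 + mu) * (2 * t) * ((3 + mu) * (5 * E - 12 * D) * (2 * t) ^ 2 +
        4 * E * (2 + mu) * (1 + mu) * (4 * t ^ 2 - 1)) := by
    rw [chi5, chi1, chebU_one, chebU_two, hD, hE]
    ring
  have h6 : chi6 mu delta t = ((2 + mu) * (3 + mu) * (5 * E - 12 * D) * (2 * t) ^ 3 +
      4 * E * (1 + mu) * (2 + mu) ^ 2 * (2 * t) * (4 * t ^ 2 - 1) +
      (1 + mu) * (2 * t) ^ 2 * (2 * E * (2 + mu) ^ 2 - 12 * D * (1 + mu) * (3 + mu))) *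
        (1 + mu) ^ 2 := by
    rw [chi6, chi2, chebU_one, chebU_two, hD, hE]
    ring
  have hf24 : coeff f 2 * coeff f 4 - coeff f 3 ^ 2 =
      3 * (coeff h 2 * coeff h 4) / D - 9 * coeff h 3 ^ 2 / E := by
    rw [a2, a3, a4, hD, hE]
    push_cast
    rw [div_mul_div_comm, div_pow]
    ring
  -- The hypothesis `ep / 4 ≤ ka` of `majorant_le`; it follows from `E ≤ 4D` and `2(2 + μ)² ≤ 3(1 +
  -- μ)(3 + μ)`.
  have hep : 6 * t ^ 2 / (D * (1 + mu) * (3 + mu)) / 4 ≤ 9 * t ^ 2 / (E * (2 + mu) ^ 2) := by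
    rw [div_div, div_le_div_iff₀ (by positivity) (by positivity)]
    have : E * (2 + mu) ^ 2 ≤ 6 * (D * (1 + mu) * (3 + mu)) := by
      have h1 : E * (2 + mu) ^ 2 ≤ 4 * D * (2 + mu) ^ 2 := by gcongr
      nlinarith [mul_nonneg hD0.le hmu, mul_nonneg hD0.le (mul_nonneg hmu hmu)]
    nlinarith [mul_le_mul_of_nonneg_left this (sq_nonneg t)]
  have hbound := norm_hankel_functional_le
    (ta := 2 * t * Omega 1 mu delta t / (6 * D * E * (3 + mu) * (1 + mu) ^ 4))
    (al := 6 * (5 * E - 12 * D) * t ^ 3 / (D * E * (1 + mu) ^ 2 * (2 + mu)))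
    (be := 6 * t * (4 * t ^ 2 - 1) / (D * (1 + mu) * (3 + mu)))
    (by positivity) (by positivity) (by positivity) hep hc hd
  rw [abs_div, abs_mul, abs_of_pos (by positivity : 0 < 2 * t),
    abs_of_pos (by positivity : 0 < 6 * D * E * (3 + mu) * (1 + mu) ^ 4)] at hbound
  have hpow : ‖c₁‖ ^ 4 = (‖c₁‖ ^ 2) ^ 2 := by ring
  rw [hpow, majorant_eq hmu hD0 hE0 h5 h6] at hbound
  have hc1n : ‖c₁‖ ≤ 1 := by
    obtain ⟨-, -, hn, -⟩ := hc
    exact hn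
  refine ⟨‖c₁‖ ^ 2, by positivity, pow_le_one₀ (norm_nonneg _) hc1n, ?_⟩
  rw [hankelDenom, ← hD, ← hE]
  convert hbound using 2
  rw [hf24, hid, hΩ]
  push_cast
  ring

/-- `phiTwo` is the value of the quadratic majorant at `P = 1`. -/
lemma phiTwo_eq (mu delta t : ℝ) :
    phiTwo mu delta t = 36 * t ^ 2 / ((2 * delta ^ 2 + 1) ^ 2 * (2 + mu) ^ 2) +
      (9 * chi6 mu delta t + chi5 mu delta t) / hankelDenom mu delta := by
  rw [phiTwo, chebU_one, hankelDenom]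
  ring_nf

/-- `phiCrit` is the value of the quadratic majorant at its vertex. -/
lemma phiCrit_eq (mu delta t : ℝ) :
    phiCrit mu delta t = 36 * t ^ 2 / ((2 * delta ^ 2 + 1) ^ 2 * (2 + mu) ^ 2) +
      -(81 * chi6 mu delta t ^ 2 / (4 * chi5 mu delta t)) / hankelDenom mu delta := by
  have h : 27 * chi6 mu delta t ^ 2 / (8 * chi5 mu delta t * delta * (delta ^ 3 + 2 * delta) *
      (2 * delta ^ 2 + 1) ^ 2 * (3 + mu) * (2 + mu) ^ 2 * (1 + mu) ^ 4) =
      81 * chi6 mu delta t ^ 2 / (4 * chi5 mu delta t) / hankelDenom mu delta := by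
    rw [div_div, ← mul_div_mul_left _ _ (three_ne_zero (α := ℝ)), hankelDenom]
    congr 1 <;> ring
  rw [phiCrit, chebU_one, h]
  ring

end BiUnivalentHankel

theorem corollary2 (mu delta t : ℝ) (hmu : 0 ≤ mu) (hdelta : 1 ≤ delta)
    (ht : 1 / 2 < t) (ht' : t ≤ 1) (f h : ℂ → ℂ) (hf : f ∈ BiUnivalentHankel.classA)
    (hconv : Set.EqOn h
      (BiUnivalentHankel.hadamard f (BiUnivalentHankel.fDelta delta))
      BiUnivalentHankel.unitDisk)
    (hB : h ∈ BiUnivalentHankel.classB mu delta t) :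
    (0 ≤ BiUnivalentHankel.chi5 mu delta t → 0 ≤ BiUnivalentHankel.chi6 mu delta t →
      ‖BiUnivalentHankel.coeff f 2 * BiUnivalentHankel.coeff f 4 -
          BiUnivalentHankel.coeff f 3 ^ 2‖ ≤
        BiUnivalentHankel.phiTwo mu delta t) ∧
    (BiUnivalentHankel.chi5 mu delta t ≤ 0 → BiUnivalentHankel.chi6 mu delta t ≤ 0 →
      ‖BiUnivalentHankel.coeff f 2 * BiUnivalentHankel.coeff f 4 -
          BiUnivalentHankel.coeff f 3 ^ 2‖ ≤
        36 * t ^ 2 / ((2 * delta ^ 2 + 1) ^ 2 * (2 + mu) ^ 2)) ∧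
    (0 < BiUnivalentHankel.chi5 mu delta t → BiUnivalentHankel.chi6 mu delta t < 0 →
      ‖BiUnivalentHankel.coeff f 2 * BiUnivalentHankel.coeff f 4 -
          BiUnivalentHankel.coeff f 3 ^ 2‖ ≤
        max (36 * t ^ 2 / ((2 * delta ^ 2 + 1) ^ 2 * (2 + mu) ^ 2))
          (BiUnivalentHankel.phiTwo mu delta t)) ∧
    (BiUnivalentHankel.chi5 mu delta t < 0 → 0 < BiUnivalentHankel.chi6 mu delta t →
      ‖BiUnivalentHankel.coeff f 2 * BiUnivalentHankel.coeff f 4 -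
          BiUnivalentHankel.coeff f 3 ^ 2‖ ≤
        max (BiUnivalentHankel.phiCrit mu delta t)
          (BiUnivalentHankel.phiTwo mu delta t)) := by
  obtain ⟨P, hP0, hP1, hP⟩ := BiUnivalentHankel.exists_hankel_le hmu hdelta ht hf hconv hB
  have hN := BiUnivalentHankel.hankelDenom_pos hmu hdelta
  rw [BiUnivalentHankel.phiTwo_eq, BiUnivalentHankel.phiCrit_eq]
  generalize BiUnivalentHankel.chi5 mu delta t = x at *
  generalize BiUnivalentHankel.chi6 mu delta t = y at *
  have hPP : P ^ 2 ≤ P := by nlinarith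
  refine ⟨fun hx hy => ?_, fun hx hy => ?_, fun hx hy => ?_, fun hx hy => ?_⟩
  · refine hP.trans (add_le_add_right (div_le_div_of_nonneg_right (add_le_add ?_ ?_) hN.le) _)
    · exact mul_le_of_le_one_right (by positivity) hP1
    · exact mul_le_of_le_one_right hx (pow_le_one₀ hP0 hP1)
  · refine hP.trans (add_le_of_nonpos_right (div_nonpos_of_nonpos_of_nonneg ?_ hN.le))
    nlinarith [mul_nonneg (neg_nonneg.2 hy) hP0, mul_nonneg (neg_nonneg.2 hx) (sq_nonneg P)]
  -- For `χ₅ > 0` the quadratic is convex and lies below its chord over `[0, 1]`; the sign of the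
  -- chord's slope selects the endpoint.
  · have hle : 9 * y * P + x * P ^ 2 ≤ P * (9 * y + x) := by nlinarith
    rcases le_total (9 * y + x) 0 with h0 | h0
    · refine le_max_of_le_left (hP.trans (add_le_of_nonpos_right
        (div_nonpos_of_nonpos_of_nonneg (hle.trans ?_) hN.le)))
      exact mul_nonpos_of_nonneg_of_nonpos hP0 h0
    · refine le_max_of_le_right (hP.trans
        (add_le_add_right (div_le_div_of_nonneg_right ?_ hN.le) _))
      exact hle.trans (mul_le_of_le_one_left h0 hP1)
  -- For `χ₅ < 0` the vertex value bounds the quadratic at every real `P`, wherever the vertex lies,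
  -- so the first entry of the maximum suffices.
  · refine le_max_of_le_left (hP.trans
      (add_le_add_right (div_le_div_of_nonneg_right ?_ hN.le) _))
    rw [← sub_nonneg]
    have heq : -(81 * y ^ 2 / (4 * x)) - (9 * y * P + x * P ^ 2) =
        (2 * x * P + 9 * y) ^ 2 / (4 * -x) := by
      field_simp [hx.ne]
      ring
    rw [heq]
    exact div_nonneg (sq_nonneg _) (by linarith)
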